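/- Let $\mathbb F$ be $\mathbb R$ or $\mathbb C$, let $n\ge 1$, and let $X=(\mathbb F^n,\|\cdot\|)$ be a normed space with closed unit ball $B_X$ and unit sphere $S_X$. Assume that the norm is absolute, i.e. $\|(a_1,\dots,a_n)\|=\|(|a_1|,\dots,|a_n|)\|$ for all scalars $a_1,\dots,a_n$ and $\|e_1\|=\dots=\|e_n\|=1$ for the canonical basis vectors, and that $X$ is a CL-space, i.e. $B_X$ is the absolutely convex hull of every maximal convex subset of $S_X$. Let $m\ge 1$ be an integer and let $\mathcal P({}^mX)$ be the space of all maps $P:X\to\mathbb F$ of the form $P(x)=L(x,\dots,x)$ with $L:X^m\to\mathbb F$ a continuous $m$-linear form, normed by $\|P\|=\sup_{x\in B_X}|P(x)|$. A point $x\in B_X$ is called a strongly norm-attaining point of $\mathcal P({}^mX)$ if there is a nonzero $P\in\mathcal P({}^mX)$ such that for every sequence $(x_k)$ in $B_X$ with $\lim_k|P(x_k)|=\|P\|$ there are a scalar $\lambda\in\mathbb F$ with $|\lambda|=1$ and a subsequence of $(x_k)$ that converges to $\lambda x$. Theorem. If $y_1,\dots,y_m$ are (not necessarily distinct) extreme points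 of $B_X$ all of whose coordinates are nonnegative real numbers, then $\frac1m\sum_{j=1}^m y_j$ is a strongly norm-attaining point of $\mathcal P({}^mX)$. -/

import Mathlib

open Set Filter Topology Metric
open scoped BoundedContinuousFunction

/-- The norm of `X` is an absolute norm in the coordinates given by the basis `b`, that is, when
`X` is identified with `𝕜 ^ n` through `b`: the norm of a vector only depends on the absolute
values of its coordinates, and the basis vectors have norm one. -/
def IsAbsoluteNorm {𝕜 X : Type*} [RCLike 𝕜] [NormedAddCommGroup X] [NormedSpace 𝕜 X] {n : ℕ}
    (b : Module.Basis (Fin n) 𝕜 X) : Prop :=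
  (∀ a : Fin n → 𝕜, ‖∑ i, a i • b i‖ = ‖∑ i, ((‖a i‖ : ℝ) : 𝕜) • b i‖) ∧ ∀ i, ‖b i‖ = 1

/-- `X` is a CL-space over `𝕜`: its closed unit ball is the absolutely convex hull (the convex hull
of the balanced hull) of every maximal convex subset of the unit sphere. -/
def IsCLSpace (𝕜 X : Type*) [RCLike 𝕜] [NormedAddCommGroup X] [NormedSpace 𝕜 X]
    [NormedSpace ℝ X] : Prop :=
  ∀ F : Set X, Maximal (fun S : Set X => S ⊆ sphere 0 1 ∧ Convex ℝ S) F →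
    convexHull ℝ (balancedHull 𝕜 F) = closedBall (0 : X) 1

/-- The nonzero function `f ∈ C_b(B_X : Y)` strongly attains its norm at `x`. -/
def StronglyAttainsNormAt (𝕜 : Type*) {X Y : Type*} [RCLike 𝕜] [NormedAddCommGroup X]
    [NormedSpace 𝕜 X] [NormedAddCommGroup Y] (f : closedBall (0 : X) 1 →ᵇ Y) (x : X) : Prop :=
  f ≠ 0 ∧ ∀ u : ℕ → closedBall (0 : X) 1, Tendsto (fun k => ‖f (u k)‖) atTop (𝓝 ‖f‖) →
    ∃ c : 𝕜, ‖c‖ = 1 ∧ ∃ φ : ℕ → ℕ, StrictMono φ ∧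
      Tendsto (fun k => (u (φ k) : X)) atTop (𝓝 (c • x))

/-- The set of all strongly norm-attaining points of a subspace `A` of `C_b(B_X : Y)`. -/
def stronglyNormAttainingPoints {𝕜 X Y : Type*} [RCLike 𝕜] [NormedAddCommGroup X]
    [NormedSpace 𝕜 X] [NormedAddCommGroup Y] [NormedSpace 𝕜 Y]
    (A : Submodule 𝕜 (closedBall (0 : X) 1 →ᵇ Y)) : Set X :=
  {x | x ∈ closedBall (0 : X) 1 ∧ ∃ f ∈ A, StronglyAttainsNormAt 𝕜 f x}

/-- The space of scalar-valued `m`-homogeneous polynomials on `X`, as a subspace of `C_b(B_X)`: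
the restrictions to the unit ball of the maps `x ↦ L (x, …, x)` with `L` a continuous `m`-linear
form. Its norm is the supremum norm over the unit ball. -/
def homogeneousPolynomials (𝕜 X : Type*) [RCLike 𝕜] [NormedAddCommGroup X] [NormedSpace 𝕜 X]
    (m : ℕ) : Submodule 𝕜 (closedBall (0 : X) 1 →ᵇ 𝕜) where
  carrier := {f | ∃ L : ContinuousMultilinearMap 𝕜 (fun _ : Fin m => X) 𝕜,
    ∀ x : closedBall (0 : X) 1, f x = L (fun _ => (x : X))}
  zero_mem' := ⟨0, fun _ => rfl⟩
  add_mem' := by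
    rintro f g ⟨L, hL⟩ ⟨M, hM⟩
    exact ⟨L + M, fun x => by simp [hL, hM]⟩
  smul_mem' := by
    rintro c f ⟨L, hL⟩
    exact ⟨c • L, fun x => by simp [hL]⟩

/-! For each coordinate s, a maximal convex subset of the sphere through `b s` yields weights a ≥ 0
with a s > 0 and ∑ a i |z i| ≤ 1 on the ball, such that for every extreme point exactly one product
a i |y i| is nonzero, and it equals 1 (`IsCLSpace.exists_coeffs`). Let k s j be that index for y j,
and ξ the coordinates of the mean x. By AM-GM, the product over j of z (k s j) / ξ (k s j) has
modulus at most 1 on the ball, and equality forces |z s| = ξ s (`eq_mean_of_forall_eq`). Adding the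
m-th power of a linear form with positive coefficients makes the phases of z agree. The sum of these
n + 1 polynomials has norm n + 1, attained only at unimodular multiples of x; compactness of the
ball makes this strong. -/

namespace IsAbsoluteNorm

variable {𝕜 X : Type*} [RCLike 𝕜] [NormedAddCommGroup X] [NormedSpace 𝕜 X] {n : ℕ}
  {b : Module.Basis (Fin n) 𝕜 X}

theorem norm_eq_of_norm_repr_eq (hb : IsAbsoluteNorm b) {z w : X}
    (h : ∀ i, ‖b.repr z i‖ = ‖b.repr w i‖) : ‖z‖ = ‖w‖ := by
  rw [← b.sum_repr z, ← b.sum_repr w, hb.1 (b.repr z), hb.1 (b.repr w)]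
  simp_rw [h]

/-- Multiplying coordinates by unimodular scalars is a linear bijection preserving the ball, hence
its extreme points. -/
theorem mem_extremePoints_of_norm_repr_eq [NormedSpace ℝ X] [IsScalarTower ℝ 𝕜 X]
    (hb : IsAbsoluteNorm b) {y w : X} (hy : y ∈ extremePoints ℝ (closedBall (0 : X) 1))
    (h : ∀ i, ‖b.repr w i‖ = ‖b.repr y i‖) : w ∈ extremePoints ℝ (closedBall (0 : X) 1) := by
  have hθ : ∀ i, ∃ θ : 𝕜ˣ, ‖(θ : 𝕜)‖ = 1 ∧ b.repr w i = (θ : 𝕜)⁻¹ * b.repr y i := fun i => by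
    by_cases h0 : b.repr y i = 0
    · have h1 : b.repr w i = 0 := by rw [← norm_eq_zero, h i, h0, norm_zero]
      exact ⟨1, by simp, by simp [h0, h1]⟩
    · have h1 : b.repr w i ≠ 0 := by rw [← norm_ne_zero_iff, h i]; exact norm_ne_zero_iff.2 h0
      refine ⟨Units.mk0 (b.repr y i / b.repr w i) (div_ne_zero h0 h1), ?_, ?_⟩
      · rw [Units.val_mk0, norm_div, h i, div_self (norm_ne_zero_iff.2 h0)]
      · rw [Units.val_mk0, inv_div, div_mul_cancel₀ _ h0]
  choose θ hθ1 hθ using hθ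
  -- Coordinates in a rescaled basis are divided by the scaling factors, hence the inverses of θ.
  let T : X ≃ₗ[𝕜] X := (b.unitsSMul θ).repr.trans b.repr.symm
  have hT : ∀ z i, b.repr (T z) i = (θ i : 𝕜)⁻¹ * b.repr z i := fun z i => by
    simp [T, Units.smul_def]
  have hTn : ∀ z, ‖T z‖ = ‖z‖ := fun z =>
    hb.norm_eq_of_norm_repr_eq fun i => by rw [hT, norm_mul, norm_inv, hθ1, inv_one, one_mul]
  have hTy : T y = w := b.repr.injective (Finsupp.ext fun i => by rw [hT, hθ])
  have hball : T.restrictScalars ℝ '' closedBall (0 : X) 1 = closedBall 0 1 := by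
    ext z
    simp only [mem_image, mem_closedBall_zero_iff, LinearEquiv.restrictScalars_apply]
    refine ⟨?_, fun hz => ⟨T.symm z, ?_, T.apply_symm_apply z⟩⟩
    · rintro ⟨z, hz, rfl⟩
      rwa [hTn]
    · rwa [← hTn, T.apply_symm_apply]
  rw [← hball, ← image_extremePoints]
  exact ⟨y, hy, hTy⟩

end IsAbsoluteNorm

/-! ### Supporting functionals of CL-spaces -/

theorem exists_maximal_convex_subset_sphere {X : Type*} [NormedAddCommGroup X] [NormedSpace ℝ X]
    {S : Set X} (hS : S ⊆ sphere 0 1) (hS' : Convex ℝ S) :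
    ∃ F, S ⊆ F ∧ Maximal (fun S : Set X => S ⊆ sphere 0 1 ∧ Convex ℝ S) F :=
  zorn_subset_nonempty {S : Set X | S ⊆ sphere 0 1 ∧ Convex ℝ S}
    (fun _ hc hchain _ => ⟨⋃₀ _, ⟨sUnion_subset fun _ hs => (hc hs).1,
      hchain.directedOn.convex_sUnion fun _ hs => (hc hs).2⟩, fun _ => subset_sUnion_of_mem⟩)
    S ⟨hS, hS'⟩

/-- Constant signs give total mass 1; flipping only the sign at k gives |1 - 2 p k| ≥ 1, so p k is 0
or 1. -/
theorem exists_eq_ite_of_one_le_abs_sum {ι : Type*} [Fintype ι] [DecidableEq ι] {p : ι → ℝ}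
    (hp : ∀ i, 0 ≤ p i) (hsum : ∑ i, p i ≤ 1)
    (hsign : ∀ ε : ι → ℝ, (∀ i, |ε i| = 1) → 1 ≤ |∑ i, ε i * p i|) :
    ∃ k, ∀ i, p i = if i = k then 1 else 0 := by
  have h1 : ∑ i, p i = 1 := by
    have := hsign (fun _ => 1) (by simp)
    simp only [one_mul, abs_of_nonneg (Finset.sum_nonneg fun i _ => hp i)] at this
    exact le_antisymm hsum this
  have hsplit : ∀ k, p k + ∑ i ∈ Finset.univ.erase k, p i = 1 := fun k => by
    rw [Finset.add_sum_erase _ _ (Finset.mem_univ k), h1]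
  have hrest : ∀ k, 0 ≤ ∑ i ∈ Finset.univ.erase k, p i := fun k =>
    Finset.sum_nonneg fun i _ => hp i
  have h01 : ∀ k, p k = 0 ∨ p k = 1 := fun k => by
    have := hsign (fun i => if i = k then -1 else 1) fun i => by split_ifs <;> simp
    rw [← Finset.add_sum_erase _ _ (Finset.mem_univ k),
      Finset.sum_congr rfl (g := p) fun i hi => by simp [Finset.ne_of_mem_erase hi]] at this
    simp only [if_true] at this
    have h2 := hsplit k
    have h3 := hrest k
    have h4 := hp k
    rcases le_abs.1 this with h | h
    · left; linarith
    · right; linarith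
  obtain ⟨k, hk⟩ : ∃ k, p k ≠ 0 := by
    by_contra! h
    simp [h] at h1
  have hk1 := (h01 k).resolve_left hk
  refine ⟨k, fun i => ?_⟩
  split_ifs with hik
  · rw [hik, hk1]
  · have h2 := hsplit k
    have := Finset.single_le_sum (fun i _ => hp i)
      (Finset.mem_erase.2 ⟨hik, Finset.mem_univ i⟩)
    linarith [hp i]

/-- A functional g separates the open ball from a maximal convex set F containing `b i₀`; the
weights are |g (b i)| / u. Extreme points lie in the balanced hull of F, so |g| ≥ u there. This also
holds after any change of coordinate phases, so the sign lemma applies. -/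
theorem IsCLSpace.exists_coeffs {𝕜 X : Type*} [RCLike 𝕜] [NormedAddCommGroup X] [NormedSpace 𝕜 X]
    [NormedSpace ℝ X] [IsScalarTower ℝ 𝕜 X] {n : ℕ} {b : Module.Basis (Fin n) 𝕜 X}
    (hX : IsCLSpace 𝕜 X) (hb : IsAbsoluteNorm b) (i₀ : Fin n) :
    ∃ a : Fin n → ℝ, (∀ i, 0 ≤ a i) ∧ 0 < a i₀ ∧
      (∀ z : X, ‖z‖ ≤ 1 → ∑ i, a i * ‖b.repr z i‖ ≤ 1) ∧
      ∀ y ∈ extremePoints ℝ (closedBall (0 : X) 1),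
        ∃ k, ∀ i, a i * ‖b.repr y i‖ = if i = k then 1 else 0 := by
  obtain ⟨F, hF₀, hF⟩ := exists_maximal_convex_subset_sphere (S := {b i₀})
    (by simpa using hb.2 i₀) (convex_singleton _)
  have hdisj : Disjoint (ball (0 : X) 1) F :=
    Set.disjoint_left.2 fun z hz hzF => by
      have h1 := hF.1.1 hzF
      simp only [mem_ball_zero_iff, mem_sphere_zero_iff_norm] at hz h1
      exact hz.ne h1
  obtain ⟨g, u, hgu, hgF⟩ := RCLike.geometric_hahn_banach_open (𝕜 := 𝕜) (convex_ball (0 : X) 1)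
    isOpen_ball hF.1.2 hdisj
  have hu : 0 < u := by simpa using hgu 0 (by simp)
  have hg_le : ∀ z : X, ‖z‖ ≤ 1 → RCLike.re (g z) ≤ u := fun z hz => by
    have hcl : closure (ball (0 : X) 1) ⊆ {z | RCLike.re (g z) ≤ u} :=
      closure_minimal (fun z hz => (hgu z hz).le)
        (isClosed_le (RCLike.continuous_re.comp g.continuous) continuous_const)
    rw [closure_ball (0 : X) one_ne_zero] at hcl
    exact hcl (by simpa using hz)
  have hg_ext : ∀ y ∈ extremePoints ℝ (closedBall (0 : X) 1), u ≤ ‖g y‖ := fun y hy => by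
    have hy1 : y ∈ balancedHull 𝕜 F := by
      rw [← hX F hF] at hy
      exact extremePoints_convexHull_subset hy
    obtain ⟨c, hc, v, hv, rfl⟩ := mem_balancedHull_iff.1 hy1
    have hgv : u ≤ ‖g v‖ := (hgF v hv).trans (RCLike.re_le_norm _)
    have hvn : ‖v‖ = 1 := by simpa using hF.1.1 hv
    have : Nontrivial X := ⟨v, 0, fun h => by simp [h] at hvn⟩
    have hc1 : ‖c‖ = 1 := by
      simpa [norm_smul, hvn] using extremePoints_closedBall_subset_sphere hy
    simpa [norm_smul, hc1] using hgv
  have hφ : ∀ i, ∃ φ : 𝕜, ‖φ‖ = 1 ∧ φ * g (b i) = (‖g (b i)‖ : 𝕜) := fun i => by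
    by_cases h0 : g (b i) = 0
    · exact ⟨1, by simp [h0]⟩
    · have h1 : (‖g (b i)‖ : 𝕜) ≠ 0 := by simpa using h0
      refine ⟨(‖g (b i)‖ : 𝕜) / g (b i), ?_, div_mul_cancel₀ _ h0⟩
      rw [norm_div, RCLike.norm_ofReal, abs_norm, div_self (norm_ne_zero_iff.2 h0)]
  choose φ hφ1 hφ using hφ
  -- The phases φ cancel those of g, so g is real on the range of W.
  let W : (Fin n → ℝ) → X := fun t => ∑ i, ((t i : 𝕜) * φ i) • b i
  have hW : ∀ t i, ‖b.repr (W t) i‖ = |t i| := fun t i => by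
    rw [b.repr_sum_self, norm_mul, hφ1, mul_one, RCLike.norm_ofReal]
  have hgW : ∀ t, g (W t) = ((∑ i, t i * ‖g (b i)‖ : ℝ) : 𝕜) := fun t => by
    simp only [W, map_sum, map_smul, smul_eq_mul, mul_assoc, hφ, RCLike.ofReal_mul]
  have hscale : ∀ t : Fin n → ℝ, ∑ i, ‖g (b i)‖ / u * t i = (∑ i, t i * ‖g (b i)‖) / u := fun t => by
    rw [Finset.sum_div]
    exact Finset.sum_congr rfl fun i _ => by ring
  have hball : ∀ z : X, ‖z‖ ≤ 1 → ∑ i, ‖g (b i)‖ / u * ‖b.repr z i‖ ≤ 1 := fun z hz => by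
    have h1 : ‖W fun i => ‖b.repr z i‖‖ = ‖z‖ :=
      hb.norm_eq_of_norm_repr_eq fun i => by rw [hW, abs_norm]
    have h2 := hg_le _ (h1.trans_le hz)
    rw [hgW, RCLike.ofReal_re] at h2
    rwa [hscale fun i => ‖b.repr z i‖, div_le_one hu]
  refine ⟨fun i => ‖g (b i)‖ / u, fun i => by positivity, ?_, hball, fun y hy => ?_⟩
  · have h1 : u ≤ ‖g (b i₀)‖ := (hgF _ (hF₀ rfl)).trans (RCLike.re_le_norm _)
    exact div_pos (hu.trans_le h1) hu
  · refine exists_eq_ite_of_one_le_abs_sum (fun i => by positivity)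
      (hball y (by simpa using extremePoints_subset hy)) fun ε hε => ?_
    have h1 := hg_ext (W fun i => ε i * ‖b.repr y i‖) <|
      hb.mem_extremePoints_of_norm_repr_eq hy fun i => by rw [hW, abs_mul, hε, abs_norm, one_mul]
    rw [hgW, RCLike.norm_ofReal] at h1
    have h2 : ∑ i, ε i * (‖g (b i)‖ / u * ‖b.repr y i‖) =
        (∑ i, ε i * ‖b.repr y i‖ * ‖g (b i)‖) / u := by
      rw [Finset.sum_div]
      exact Finset.sum_congr rfl fun i _ => by ring
    rwa [h2, abs_div, abs_of_pos hu, le_div_iff₀ hu, one_mul]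

/-- Supplies n ≥ 1: in the zero space the sphere is empty, and an empty hull is not the ball. -/
theorem IsCLSpace.nontrivial {𝕜 X : Type*} [RCLike 𝕜] [NormedAddCommGroup X] [NormedSpace 𝕜 X]
    [NormedSpace ℝ X] (hX : IsCLSpace 𝕜 X) : Nontrivial X := by
  by_contra hsub
  rw [not_nontrivial_iff_subsingleton] at hsub
  obtain ⟨F, -, hF⟩ := exists_maximal_convex_subset_sphere (empty_subset (sphere (0 : X) 1))
    convex_empty
  have hF0 : F = ∅ := by
    have h := hF.1.1
    rwa [sphere_eq_empty_of_subsingleton one_ne_zero, subset_empty_iff] at h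
  have h := hX F hF
  have hhull : balancedHull 𝕜 F = ∅ := by
    simp [hF0, balancedHull]
  rw [hhull, convexHull_empty] at h
  exact (nonempty_closedBall.2 zero_le_one).ne_empty h.symm

/-! ### AM-GM, the triangle inequality and their equality cases -/

/-- AM-GM via r ≤ exp (r - 1), which is strict unless r = 1; the strictness gives the equality case
below. -/
theorem prod_le_one_of_sum_le_card {ι : Type*} [Fintype ι] {r : ι → ℝ} (hr : ∀ j, 0 ≤ r j)
    (hsum : ∑ j, r j ≤ Fintype.card ι) : ∏ j, r j ≤ 1 := by
  calc ∏ j, r j ≤ ∏ j, Real.exp (r j - 1) :=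
        Finset.prod_le_prod (fun j _ => hr j) fun j _ => by linarith [Real.add_one_le_exp (r j - 1)]
    _ = Real.exp (∑ j, r j - Fintype.card ι) := by
        rw [← Real.exp_sum, Finset.sum_sub_distrib]; simp
    _ ≤ 1 := Real.exp_le_one_iff.2 (by linarith)

theorem eq_one_of_one_le_prod_of_sum_le_card {ι : Type*} [Fintype ι] {r : ι → ℝ}
    (hr : ∀ j, 0 ≤ r j) (hsum : ∑ j, r j ≤ Fintype.card ι) (hprod : 1 ≤ ∏ j, r j) (j : ι) :
    r j = 1 := by
  by_contra hj
  have hpos : ∀ i, 0 < r i := fun i => (hr i).lt_of_ne' fun h0 => by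
    rw [Finset.prod_eq_zero (Finset.mem_univ i) h0] at hprod
    linarith
  have : ∏ j, r j < ∏ j, Real.exp (r j - 1) :=
    Finset.prod_lt_prod (fun i _ => hpos i)
      (fun i _ => by linarith [Real.add_one_le_exp (r i - 1)])
      ⟨j, Finset.mem_univ j, by linarith [Real.add_one_lt_exp (sub_ne_zero.2 hj)]⟩
  rw [← Real.exp_sum] at this
  have h1 : Real.exp (∑ j, (r j - 1)) ≤ 1 := by
    rw [Real.exp_le_one_iff, Finset.sum_sub_distrib]
    simpa using hsum
  linarith

/-- The equality case of the triangle inequality for positively weighted sums of scalars. -/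
theorem RCLike.eq_mul_norm_of_sum_mul_norm_le {𝕜 ι : Type*} [RCLike 𝕜] [Fintype ι] {α : ι → ℝ}
    (hα : ∀ i, 0 < α i) {z : ι → 𝕜} (hsum : ∑ i, α i * ‖z i‖ ≤ 1)
    (hnorm : ‖∑ i, (α i : 𝕜) * z i‖ = 1) (i : ι) :
    z i = (∑ i, (α i : 𝕜) * z i) * (‖z i‖ : 𝕜) := by
  set c := ∑ i, (α i : 𝕜) * z i with hc
  have hcc : c * star c = 1 := by
    rw [RCLike.star_def, RCLike.mul_conj, hnorm]; simp
  have hn : ∀ i, ‖star c * z i‖ = ‖z i‖ := fun i => by rw [norm_mul, norm_star, hnorm, one_mul]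
  have hre : ∑ i, α i * RCLike.re (star c * z i) = 1 := by
    have : ∑ i, (α i : 𝕜) * (star c * z i) = 1 := by
      rw [← hcc, mul_comm c, hc, Finset.mul_sum]
      exact Finset.sum_congr rfl fun i _ => by ring
    simpa [RCLike.re_ofReal_mul] using congrArg RCLike.re this
  have hle : ∀ i, α i * RCLike.re (star c * z i) ≤ α i * ‖z i‖ := fun i =>
    mul_le_mul_of_nonneg_left ((RCLike.re_le_norm _).trans (hn i).le) (hα i).le
  have heq := (Finset.sum_eq_sum_iff_of_le fun i _ => hle i).1
    (le_antisymm (Finset.sum_le_sum fun i _ => hle i) (hre ▸ hsum)) i (Finset.mem_univ i)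
  have h1 : RCLike.re (star c * z i) = ‖star c * z i‖ := by
    rw [hn]; exact mul_left_cancel₀ (hα i).ne' heq
  have h2 : star c * z i = (‖z i‖ : 𝕜) := by
    rw [← hn i]
    exact RCLike.norm_le_re_iff_eq_norm.1 h1.ge
  rw [← h2, ← mul_assoc, hcc, one_mul]

/-- A function whose norm is maximal on the unit ball only at the unimodular multiples of a point
strongly attains its norm there. -/
theorem stronglyAttainsNormAt_of_forall_norm_le {𝕜 X Y : Type*} [RCLike 𝕜] [NormedAddCommGroup X]
    [NormedSpace 𝕜 X] [ProperSpace X] [NormedAddCommGroup Y] {f : closedBall (0 : X) 1 →ᵇ Y}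
    (hf : f ≠ 0) {x : X}
    (h : ∀ z : closedBall (0 : X) 1, ‖f‖ ≤ ‖f z‖ → ∃ c : 𝕜, ‖c‖ = 1 ∧ (z : X) = c • x) :
    StronglyAttainsNormAt 𝕜 f x := by
  refine ⟨hf, fun u hu => ?_⟩
  have : CompactSpace (closedBall (0 : X) 1) :=
    isCompact_iff_compactSpace.1 (isCompact_closedBall _ _)
  obtain ⟨z, φ, hφ, hz⟩ := CompactSpace.tendsto_subseq u
  have hfz : ‖f z‖ = ‖f‖ := tendsto_nhds_unique
    ((f.continuous.norm.tendsto z).comp hz) (hu.comp hφ.tendsto_atTop)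
  obtain ⟨c, hc, hzc⟩ := h z hfz.ge
  exact ⟨c, hc, φ, hφ, hzc ▸ (continuous_subtype_val.tendsto z).comp hz⟩

theorem exists_continuousMultilinearMap_prod {𝕜 X : Type*} [RCLike 𝕜] [NormedAddCommGroup X]
    [NormedSpace 𝕜 X] {m : ℕ} (l : Fin m → X →L[𝕜] 𝕜) :
    ∃ L : ContinuousMultilinearMap 𝕜 (fun _ : Fin m => X) 𝕜, ∀ z, L (fun _ => z) = ∏ j, l j z :=
  ⟨(ContinuousMultilinearMap.mkPiAlgebra 𝕜 (Fin m) 𝕜).compContinuousLinearMap l, fun z => by simp⟩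

/-! ### Weighted sums over the coordinates of the mean -/

theorem sum_div_mean_le {ι : Type*} [Fintype ι] [DecidableEq ι] {m : ℕ} (hm : 0 < m)
    {a ξ t : ι → ℝ} {η : Fin m → ι → ℝ} {k : Fin m → ι} (ha : ∀ i, 0 ≤ a i) (ht : ∀ i, 0 ≤ t i)
    (hk : ∀ j i, a i * η j i = if i = k j then 1 else 0) (hξ : ∀ i, ξ i = (∑ j, η j i) / m)
    (hat : ∑ i, a i * t i ≤ 1) : ∑ j, t (k j) / ξ (k j) ≤ m := by
  have hm' : (0 : ℝ) < m := by exact_mod_cast hm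
  calc ∑ j, t (k j) / ξ (k j) = ∑ j, ∑ i, a i * η j i * (t i / ξ i) := by simp [hk]
    _ = ∑ i, a i * (m * ξ i) * (t i / ξ i) := by
        rw [Finset.sum_comm]
        refine Finset.sum_congr rfl fun i _ => ?_
        rw [← Finset.sum_mul, ← Finset.mul_sum, hξ, mul_div_cancel₀ _ hm'.ne']
    _ ≤ ∑ i, m * (a i * t i) := by
        refine Finset.sum_le_sum fun i _ => ?_
        -- Where ξ vanishes, division by zero gives 0, so only an inequality survives.
        rcases eq_or_ne (ξ i) 0 with h0 | h0
        · rw [h0, div_zero, mul_zero]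
          exact mul_nonneg hm'.le (mul_nonneg (ha i) (ht i))
        · exact le_of_eq (by field_simp)
    _ ≤ m := by
        rw [← Finset.mul_sum]
        exact mul_le_of_le_one_right hm'.le hat

theorem sum_mul_mean_eq_one {ι : Type*} [Fintype ι] [DecidableEq ι] {m : ℕ} (hm : 0 < m)
    {a ξ : ι → ℝ} {η : Fin m → ι → ℝ} {k : Fin m → ι}
    (hk : ∀ j i, a i * η j i = if i = k j then 1 else 0) (hξ : ∀ i, ξ i = (∑ j, η j i) / m) :
    ∑ i, a i * ξ i = 1 := by
  have hm' : (m : ℝ) ≠ 0 := by exact_mod_cast hm.ne'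
  calc ∑ i, a i * ξ i = (∑ j, ∑ i, a i * η j i) / m := by
        rw [Finset.sum_comm, Finset.sum_div]
        exact Finset.sum_congr rfl fun i _ => by rw [hξ, ← Finset.mul_sum, mul_div_assoc]
    _ = 1 := by simp [hk, hm']

theorem mean_pos {ι : Type*} [DecidableEq ι] {m : ℕ} {a ξ : ι → ℝ} {η : Fin m → ι → ℝ}
    {k : Fin m → ι} (hη : ∀ j i, 0 ≤ η j i)
    (hk : ∀ j i, a i * η j i = if i = k j then 1 else 0) (hξ : ∀ i, ξ i = (∑ j, η j i) / m)
    (j : Fin m) : 0 < ξ (k j) := by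
  have h1 := hk j (k j)
  rw [if_pos rfl] at h1
  have h2 : 0 < η j (k j) := (hη j _).lt_of_ne' fun h0 => by simp [h0] at h1
  have hm : (0 : ℝ) < m := by exact_mod_cast j.pos
  rw [hξ]
  exact div_pos (Finset.sum_pos' (fun j _ => hη j _) ⟨j, Finset.mem_univ j, h2⟩) hm

theorem eq_mean_of_forall_eq {ι : Type*} [Fintype ι] [DecidableEq ι] {m : ℕ} (hm : 0 < m)
    {a ξ t : ι → ℝ} {η : Fin m → ι → ℝ} {k : Fin m → ι} {s : ι} (ha : ∀ i, 0 ≤ a i) (has : 0 < a s)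
    (ht : ∀ i, 0 ≤ t i)
    (hk : ∀ j i, a i * η j i = if i = k j then 1 else 0) (hξ : ∀ i, ξ i = (∑ j, η j i) / m)
    (hat : ∑ i, a i * t i ≤ 1) (h : ∀ j, t (k j) = ξ (k j)) : t s = ξ s := by
  -- Such an index is some k j. Elsewhere a i * ξ i = 0, so a * ξ ≤ a * t termwise, and comparing
  -- sums forces equality.
  have key : ∀ i, a i ≠ 0 → ξ i ≠ 0 → t i = ξ i := fun i hai h0 => by
    obtain ⟨j, hj⟩ : ∃ j, η j i ≠ 0 := by
      by_contra! hall
      simp [hξ, hall] at h0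
    have h1 := hk j i
    have h2 : i = k j := by
      by_contra hne
      rw [if_neg hne] at h1
      exact mul_ne_zero hai hj h1
    rw [h2, h]
  have hle : ∀ i, a i * ξ i ≤ a i * t i := fun i => by
    rcases eq_or_ne (a i) 0 with h1 | h1
    · simp [h1]
    rcases eq_or_ne (ξ i) 0 with h2 | h2
    · rw [h2, mul_zero]
      exact mul_nonneg (ha i) (ht i)
    · rw [key i h1 h2]
  have heq := (Finset.sum_eq_sum_iff_of_le fun i _ => hle i).1
    (le_antisymm (Finset.sum_le_sum fun i _ => hle i)
      (hat.trans (sum_mul_mean_eq_one hm hk hξ).ge)) s (Finset.mem_univ s)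
  exact (mul_left_cancel₀ has.ne' heq).symm

/-! ### The peaking polynomial -/

theorem mainTheorem5 {𝕜 X : Type*} [RCLike 𝕜] [NormedAddCommGroup X] [NormedSpace 𝕜 X]
    [NormedSpace ℝ X] [IsScalarTower ℝ 𝕜 X] {n : ℕ} (b : Module.Basis (Fin n) 𝕜 X)
    (hb : IsAbsoluteNorm b) (hX : IsCLSpace 𝕜 X) {m : ℕ} (hm : 0 < m) (y : Fin m → X)
    (hy : ∀ j, y j ∈ extremePoints ℝ (closedBall (0 : X) 1))
    (hy_nonneg : ∀ j i, ∃ r : ℝ, 0 ≤ r ∧ b.repr (y j) i = (r : 𝕜)) :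
    (1 / (m : 𝕜)) • ∑ j, y j ∈ stronglyNormAttainingPoints (homogeneousPolynomials 𝕜 X m) := by
  have hfin : FiniteDimensional 𝕜 X := b.finiteDimensional_of_finite
  have hproper : ProperSpace X := FiniteDimensional.proper 𝕜 X
  have hcompact : CompactSpace (closedBall (0 : X) 1) :=
    isCompact_iff_compactSpace.1 (isCompact_closedBall _ _)
  have hnt := hX.nontrivial
  have hne : Nonempty (Fin n) := b.index_nonempty
  have hn : (0 : ℝ) < n := by exact_mod_cast Fin.pos_iff_nonempty.2 hne
  have hm' : (0 : ℝ) < m := by exact_mod_cast hm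
  choose η hη hyη using hy_nonneg
  choose a ha has hball hext using fun s => hX.exists_coeffs hb s
  choose k hk using fun s j => hext s (y j) (hy j)
  replace hk : ∀ s j i, a s i * η j i = if i = k s j then 1 else 0 := fun s j i => by
    rw [← hk s j i, hyη, RCLike.norm_ofReal, abs_of_nonneg (hη j i)]
  set x : X := (1 / (m : 𝕜)) • ∑ j, y j with hx
  let ξ : Fin n → ℝ := fun i => (∑ j, η j i) / m
  have hξ : ∀ i, ξ i = (∑ j, η j i) / m := fun _ => rfl
  have hxξ : ∀ i, b.repr x i = (ξ i : 𝕜) := fun i => by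
    simp [hx, hξ, hyη, div_eq_inv_mul]
  have hx1 : ‖x‖ ≤ 1 := by
    have h1 : ‖∑ j, y j‖ ≤ m := by
      refine (norm_sum_le _ _).trans ((Finset.sum_le_sum (g := fun _ => 1) fun j _ => ?_).trans
        (by simp))
      simpa using extremePoints_subset (hy j)
    rw [hx, norm_smul, norm_div, norm_one, RCLike.norm_natCast, one_div, inv_mul_le_one₀ hm']
    exact h1
  have hξpos : ∀ s j, 0 < ξ (k s j) := fun s j => mean_pos hη (hk s) hξ j
  -- Averaging over s makes every weight positive, so the triangle equality case controls all
  -- phases.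
  let α : Fin n → ℝ := fun i => (∑ s, a s i) / n
  have hα : ∀ i, 0 < α i := fun i =>
    div_pos (Finset.sum_pos' (fun s _ => ha s i) ⟨i, Finset.mem_univ i, has i⟩) hn
  have hαsum : ∀ t : Fin n → ℝ, ∑ i, α i * t i = (∑ s, ∑ i, a s i * t i) / n := fun t => by
    rw [Finset.sum_comm, Finset.sum_div]
    exact Finset.sum_congr rfl fun i _ => by rw [← Finset.sum_mul, div_mul_eq_mul_div]
  have hαball : ∀ z : X, ‖z‖ ≤ 1 → ∑ i, α i * ‖b.repr z i‖ ≤ 1 := fun z hz => by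
    rw [hαsum fun i => ‖b.repr z i‖, div_le_one hn]
    exact (Finset.sum_le_sum (g := fun _ => 1) fun s _ => hball s z hz).trans (by simp)
  have hαξ : ∑ i, α i * ξ i = 1 := by
    rw [hαsum ξ, Finset.sum_congr rfl fun s _ => sum_mul_mean_eq_one hm (hk s) hξ]
    simp [hn.ne']
  let coord : Fin n → X →L[𝕜] 𝕜 := fun i => LinearMap.toContinuousLinearMap (b.coord i)
  choose L hL using fun s => exists_continuousMultilinearMap_prod (m := m)
    fun j => ((ξ (k s j) : 𝕜)⁻¹ • coord (k s j))
  obtain ⟨M, hM⟩ := exists_continuousMultilinearMap_prod (m := m)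
    fun _ => ∑ i, (α i : 𝕜) • coord i
  replace hL : ∀ s z, L s (fun _ => z) = ∏ j, (ξ (k s j) : 𝕜)⁻¹ * b.repr z (k s j) :=
    fun s z => by simp [hL, coord]
  replace hM : ∀ z, M (fun _ => z) = (∑ i, (α i : 𝕜) * b.repr z i) ^ m :=
    fun z => by simp [hM, coord]
  let P : ContinuousMultilinearMap 𝕜 (fun _ : Fin m => X) 𝕜 := ∑ s, L s + M
  have hP : ∀ z, P (fun _ => z) = ∑ s, L s (fun _ => z) + M (fun _ => z) := fun z => by simp [P]
  let f : closedBall (0 : X) 1 →ᵇ 𝕜 := BoundedContinuousFunction.mkOfCompact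
    ⟨fun z => P fun _ => (z : X), P.cont.comp (by fun_prop)⟩
  have hf : ∀ z, f z = P fun _ => (z : X) := fun _ => rfl
  have hLn : ∀ s z, ‖L s fun _ => z‖ = ∏ j, ‖b.repr z (k s j)‖ / ξ (k s j) := fun s z => by
    rw [hL, norm_prod]
    refine Finset.prod_congr rfl fun j _ => ?_
    rw [norm_mul, norm_inv, RCLike.norm_ofReal, abs_of_pos (hξpos s j), div_eq_inv_mul]
  have hrnn : ∀ s z j, 0 ≤ ‖b.repr z (k s j)‖ / ξ (k s j) := fun s z j =>
    div_nonneg (norm_nonneg _) (hξpos s j).le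
  have hrsum : ∀ s z, ‖z‖ ≤ 1 →
      ∑ j, ‖b.repr z (k s j)‖ / ξ (k s j) ≤ Fintype.card (Fin m) := fun s z hz => by
    rw [Fintype.card_fin]
    exact sum_div_mean_le (t := fun i => ‖b.repr z i‖) hm (ha s) (fun _ => norm_nonneg _) (hk s) hξ
      (hball s z hz)
  have hL1 : ∀ s z, ‖z‖ ≤ 1 → ‖L s fun _ => z‖ ≤ 1 := fun s z hz => by
    rw [hLn]
    exact prod_le_one_of_sum_le_card (hrnn s z) (hrsum s z hz)
  have hh1 : ∀ z, ‖z‖ ≤ 1 → ‖∑ i, (α i : 𝕜) * b.repr z i‖ ≤ 1 := fun z hz => by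
    refine (norm_sum_le _ _).trans (le_trans (le_of_eq ?_) (hαball z hz))
    refine Finset.sum_congr rfl fun i _ => ?_
    rw [norm_mul, RCLike.norm_ofReal, abs_of_pos (hα i)]
  have hM1 : ∀ z, ‖z‖ ≤ 1 → ‖M fun _ => z‖ ≤ 1 := fun z hz => by
    rw [hM, norm_pow]
    exact pow_le_one₀ (norm_nonneg _) (hh1 z hz)
  have hPx : P (fun _ => x) = (n : 𝕜) + 1 := by
    have h1 : ∀ s, L s (fun _ => x) = 1 := fun s => by
      rw [hL]
      refine Finset.prod_eq_one fun j _ => ?_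
      rw [hxξ]
      exact inv_mul_cancel₀ (by exact_mod_cast (hξpos s j).ne')
    have h2 : ∑ i, (α i : 𝕜) * (ξ i : 𝕜) = 1 := by exact_mod_cast hαξ
    rw [hP, hM]
    simp [h1, hxξ, h2]
  have hfx : (n : ℝ) + 1 ≤ ‖f‖ := by
    refine le_trans (le_of_eq ?_) (f.norm_coe_le_norm ⟨x, by simpa using hx1⟩)
    rw [hf, hPx]
    have : ((n : 𝕜) + 1) = ((n + 1 : ℕ) : 𝕜) := by push_cast; rfl
    rw [this, RCLike.norm_natCast]
    push_cast; rfl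
  refine ⟨by simpa using hx1, f, ⟨P, hf⟩, stronglyAttainsNormAt_of_forall_norm_le
    (norm_pos_iff.1 (by linarith)) ?_⟩
  rintro ⟨z, hz⟩ hfz
  rw [mem_closedBall_zero_iff] at hz
  -- All n + 1 summands are at most 1, so each must equal 1.
  have hsum : (n : ℝ) + 1 ≤ ∑ s, ‖L s fun _ => z‖ + ‖M fun _ => z‖ := by
    refine (hfx.trans hfz).trans ?_
    rw [hf, hP]
    exact (norm_add_le _ _).trans (add_le_add_left (norm_sum_le _ _) _)
  have hsumL : ∑ s, ‖L s fun _ => z‖ ≤ n :=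
    (Finset.sum_le_sum (g := fun _ => 1) fun s _ => hL1 s z hz).trans (by simp)
  have hLeq : ∀ s, ‖L s fun _ => z‖ = 1 := fun s => by
    refine (Finset.sum_eq_sum_iff_of_le (g := fun _ => (1 : ℝ)) fun s _ => hL1 s z hz).1 ?_ s
      (Finset.mem_univ s)
    refine le_antisymm (Finset.sum_le_sum fun s _ => hL1 s z hz) ?_
    have := hM1 z hz
    simp only [Finset.sum_const, Finset.card_univ, Fintype.card_fin, nsmul_eq_mul, mul_one]
    linarith
  have hcoord : ∀ s, ‖b.repr z s‖ = ξ s := fun s =>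
    eq_mean_of_forall_eq (t := fun i => ‖b.repr z i‖) hm (ha s) (has s) (fun _ => norm_nonneg _)
      (hk s) hξ (hball s z hz) fun j => by
        rw [← div_eq_one_iff_eq (hξpos s j).ne']
        exact eq_one_of_one_le_prod_of_sum_le_card (hrnn s z) (hrsum s z hz)
          ((hLn s z).symm.trans (hLeq s)).ge j
  have hnorm : ‖∑ i, (α i : 𝕜) * b.repr z i‖ = 1 := by
    have h1 : ‖M fun _ => z‖ = 1 := le_antisymm (hM1 z hz) (by linarith)
    rwa [hM, norm_pow, pow_eq_one_iff_of_nonneg (norm_nonneg _) hm.ne'] at h1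
  refine ⟨_, hnorm, b.repr.injective (Finsupp.ext fun i => ?_)⟩
  rw [map_smul, Finsupp.smul_apply, smul_eq_mul, hxξ, ← hcoord i]
  exact RCLike.eq_mul_norm_of_sum_mul_norm_le hα (hαball z hz) hnorm i
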